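/- Let $n\ge 1$ be an integer and $s\in(0,1)$. Let $$C(n,s):=\Big(\int_{\mathbb R^n}\frac{1-\cos\omega_1}{|\omega|^{n+2s}}\,d\omega\Big)^{-1},$$ let $\omega_n$ be the $(n-1)$-dimensional surface measure of the unit sphere $\partial B_1\subset\mathbb R^n$ (so $\omega_1=2$), and let $B(\alpha,\beta)=\Gamma(\alpha)\Gamma(\beta)/\Gamma(\alpha+\beta)$ be the Beta function. For $u:\mathbb R^n\to\mathbb R$ put $$(-\Delta)^s u(x):=\frac{C(n,s)}{2}\int_{\mathbb R^n}\frac{2u(x)-u(x+y)-u(x-y)}{|y|^{n+2s}}\,dy$$ whenever the integral converges absolutely. Let $\mathcal U(x):=(1-|x|^2)_+^s$ for $x\in\mathbb R^n$. Then $C(n,s)$ is a well-defined positive finite number, and for every $x$ in the open unit ball $B_1$ the integral defining $(-\Delta)^s\,\mathcal U(x)$ converges absolutely and $$(-\Delta)^s\,\mathcal U(x)=C(n,s)\,\frac{\omega_n}{2}\,B(s,1-s).$$ Equivalently, in the principal value form of the operator, $$\mathrm{P.V.}\int_{\mathbb R^n}\frac{\mathcal U(x)-\mathcal U(y)}{|x-y|^{n+2s}}\,dy:=\lim_{\varepsilon\to0^+}\int_{\mathbb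 R^n\setminus B_\varepsilon(x)}\frac{\mathcal U(x)-\mathcal U(y)}{|x-y|^{n+2s}}\,dy=\frac{\omega_n}{2}\,B(s,1-s),$$ where the integrals over $\mathbb R^n\setminus B_\varepsilon(x)$ converge absolutely and the limit exists. -/

import Mathlib

open MeasureTheory Filter Topology

namespace FracLap

/-- The normalizing constant `C(n,s) = (∫_{ℝⁿ} (1 - cos ω₁) / |ω|^{n+2s} dω)⁻¹`;
the first coordinate of `ω` has index `0`. -/
noncomputable def fracConst (n : ℕ) [NeZero n] (s : ℝ) : ℝ :=
  (∫ ω : EuclideanSpace ℝ (Fin n), (1 - Real.cos (ω 0)) / ‖ω‖ ^ ((n : ℝ) + 2 * s))⁻¹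

/-- The second difference quotient `(2u(x) - u(x+y) - u(x-y)) / |y|^{n+2s}`. -/
noncomputable def secondDiffQuot {n : ℕ} (s : ℝ) (u : EuclideanSpace ℝ (Fin n) → ℝ)
    (x y : EuclideanSpace ℝ (Fin n)) : ℝ :=
  (2 * u x - u (x + y) - u (x - y)) / ‖y‖ ^ ((n : ℝ) + 2 * s)

/-- `(-Δ)^s u(x) = (C(n,s)/2) ∫_{ℝⁿ} (2u(x) - u(x+y) - u(x-y)) / |y|^{n+2s} dy`. It has its
intended meaning when the integrand is integrable. -/
noncomputable def fracLaplacian {n : ℕ} [NeZero n] (s : ℝ) (u : EuclideanSpace ℝ (Fin n) → ℝ)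
    (x : EuclideanSpace ℝ (Fin n)) : ℝ :=
  fracConst n s / 2 * ∫ y, secondDiffQuot s u x y

/-- The principal value integral `P.V. ∫_{ℝⁿ} f(y) dy` with singularity at `x` exists and equals
`a`: `f` is integrable off every ball about `x`, and the integrals over the complements of the
balls of radius `ε` converge to `a` as `ε → 0⁺`. -/
def HasPVIntegral {n : ℕ} (f : EuclideanSpace ℝ (Fin n) → ℝ) (x : EuclideanSpace ℝ (Fin n))
    (a : ℝ) : Prop :=
  (∀ ε : ℝ, 0 < ε → IntegrableOn f (Metric.ball x ε)ᶜ) ∧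
    Tendsto (fun ε : ℝ => ∫ y in (Metric.ball x ε)ᶜ, f y) (𝓝[>] 0) (𝓝 a)

/-- `𝒰(x) = (1 - |x|²)₊^s`. -/
noncomputable def ballPower (n : ℕ) (s : ℝ) (x : EuclideanSpace ℝ (Fin n)) : ℝ :=
  (max (1 - ‖x‖ ^ 2) 0) ^ s

/-- `ω_n`, the surface measure of the unit sphere of `ℝⁿ`. -/
noncomputable def sphereArea (n : ℕ) : ℝ :=
  (volume : Measure (EuclideanSpace ℝ (Fin n))).toSphere.real Set.univ

end FracLap

/-! In polar coordinates `y = rθ`, put `c = 1 - |x|²` and `b = ⟨x, θ⟩`, so that `1 - |x ± rθ|² = c ∓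
2br - r²`. The claim reduces to one variable: along every direction the second difference,
integrated against `r^(-1-2s)` over `(0, ∞)`, equals `B(s, 1-s)`, whatever `b` and `c` are
(`integral_Ioi_zero_chordDiff`).

Cut off at `r > δ` and treat the two rays of the chord separately. On one ray substitute `x = r² /
(c - 2br)`, with inverse `r = -bx + √(b²x² + cx)`. The integrand becomes `(1-x)^s x^(-s)` times
`1/(2x)` minus a term odd in `b`. Integrating the first part by parts yields a boundary term and
minus half the Beta integral (`integral_Ioi_chord`).

Adding the opposite ray, which has `-b`, the boundary terms combine with the tail of `2c^s
r^(-1-2s)` into `δ^(-2s)/(2s)` times the second difference at `δ`. The odd parts cancel except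
between two slightly different lower limits. Both errors are `O(δ^(2-2s))`, which vanishes because
`s < 1`.

Integrating the constant over the sphere gives the operator; symmetrizing `z ↦ -z` gives the
principal value. -/

namespace FracLap

/-! ### Second-order estimates near the center of a chord -/

/-- Second order Taylor bound for `t ↦ (1 + t) ^ s` with `s ∈ [0, 1]`. -/
theorem abs_one_add_rpow_sub_le {s t : ℝ} (hs₀ : 0 ≤ s) (hs₁ : s ≤ 1) (ht : |t| ≤ 1 / 2) :
    |(1 + t) ^ s - 1 - s * t| ≤ 2 * t ^ 2 := by
  obtain ⟨h1, h2⟩ := abs_le.1 ht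
  have hu : (1 + t) ^ s ≤ 1 + s * t := rpow_one_add_le_one_add_mul_self (by linarith) hs₀ hs₁
  -- Bernoulli for the complementary exponent, multiplied by `(1 + t)^s`, gives the lower bound; the
  -- resulting defect is `s(1-s)t²`.
  have hv : (1 + t) ^ (1 - s) ≤ 1 + (1 - s) * t :=
    rpow_one_add_le_one_add_mul_self (by linarith) (by linarith) (by linarith)
  have hp : (1 + t) ^ s * (1 + t) ^ (1 - s) = 1 + t := by
    rw [← Real.rpow_add (by linarith)]; simp
  have h0 : 0 < (1 + t) ^ s := Real.rpow_pos_of_pos (by linarith) _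
  have hd : 1 / 2 ≤ 1 + (1 - s) * t := by nlinarith
  have hl : 1 + t ≤ (1 + t) ^ s * (1 + (1 - s) * t) := by
    calc 1 + t = (1 + t) ^ s * (1 + t) ^ (1 - s) := hp.symm
      _ ≤ _ := mul_le_mul_of_nonneg_left hv h0.le
  have key : (1 + s * t - (1 + t) ^ s) * (1 + (1 - s) * t) ≤ t ^ 2 := by
    have hs2 : s * (1 - s) * t ^ 2 ≤ 1 * t ^ 2 := by
      gcongr; nlinarith
    nlinarith
  have h3 : (1 + s * t - (1 + t) ^ s) * (1 / 2) ≤ t ^ 2 :=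
    (mul_le_mul_of_nonneg_left hd (by linarith)).trans key
  rw [abs_le]
  constructor <;> nlinarith [sq_nonneg t]

theorem abs_add_rpow_sub_le {s c t : ℝ} (hs₀ : 0 ≤ s) (hs₁ : s ≤ 1) (hc : 0 < c)
    (ht : |t| ≤ c / 2) :
    |(c + t) ^ s - c ^ s - s * c ^ (s - 1) * t| ≤ 2 * c ^ (s - 2) * t ^ 2 := by
  have h1 : |t / c| ≤ 1 / 2 := by
    rw [abs_div, abs_of_pos hc, div_le_iff₀ hc]; linarith
  have h := abs_one_add_rpow_sub_le hs₀ hs₁ h1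
  obtain ⟨h2, -⟩ := abs_le.1 h1
  have hct : c + t = c * (1 + t / c) := by field_simp
  have e1 : c ^ (s - 1) = c ^ s / c := Real.rpow_sub_one hc.ne' s
  have e2 : c ^ (s - 2) = c ^ s / c ^ 2 := by
    rw [Real.rpow_sub hc]; norm_num
  have hcs : 0 < c ^ s := Real.rpow_pos_of_pos hc _
  rw [hct, Real.mul_rpow hc.le (by linarith), e1, e2]
  calc |c ^ s * (1 + t / c) ^ s - c ^ s - s * (c ^ s / c) * t|
      = |c ^ s * ((1 + t / c) ^ s - 1 - s * (t / c))| := by congr 1; ring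
    _ = c ^ s * |(1 + t / c) ^ s - 1 - s * (t / c)| := by rw [abs_mul, abs_of_pos hcs]
    _ ≤ c ^ s * (2 * (t / c) ^ 2) := by gcongr
    _ = _ := by ring

/-- The symmetric second difference of `𝒰` along a line, in terms of `c = 1 - |x|²`,
`β = ⟨x, y⟩` and `r = |y|`. -/
noncomputable def chordDiff (s c β r : ℝ) : ℝ :=
  2 * c ^ s - (max (c - 2 * β - r ^ 2) 0) ^ s - (max (c + 2 * β - r ^ 2) 0) ^ s

/-- The linear terms `±2β` cancel, leaving `-r²` twice, hence `2s c^(s-1) r²`. Each increment is at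
most `3r ≤ c/2`, so the two Taylor remainders total `2 · 2 · 9 = 36`. -/
theorem chordDiff_le {s c β r : ℝ} (hs₀ : 0 ≤ s) (hs₁ : s ≤ 1) (hc : 0 < c) (hc₁ : c ≤ 1)
    (hβ : |β| ≤ r) (hr : r ≤ c / 6) :
    |chordDiff s c β r| ≤ (2 * s * c ^ (s - 1) + 36 * c ^ (s - 2)) * r ^ 2 := by
  obtain ⟨hβ1, hβ2⟩ := abs_le.1 hβ
  have hr0 : 0 ≤ r := (abs_nonneg _).trans hβ
  have hrr : r ^ 2 ≤ r := by nlinarith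
  have hx : |-2 * β - r ^ 2| ≤ 3 * r := abs_le.2 ⟨by nlinarith, by nlinarith⟩
  have hy : |2 * β - r ^ 2| ≤ 3 * r := abs_le.2 ⟨by nlinarith, by nlinarith⟩
  have h1 := abs_add_rpow_sub_le hs₀ hs₁ hc (t := -2 * β - r ^ 2) (by linarith)
  have h2 := abs_add_rpow_sub_le hs₀ hs₁ hc (t := 2 * β - r ^ 2) (by linarith)
  have hx2 : (-2 * β - r ^ 2) ^ 2 ≤ 9 * r ^ 2 := by
    rw [← sq_abs]; nlinarith [abs_nonneg (-2 * β - r ^ 2)]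
  have hy2 : (2 * β - r ^ 2) ^ 2 ≤ 9 * r ^ 2 := by
    rw [← sq_abs]; nlinarith [abs_nonneg (2 * β - r ^ 2)]
  have hq : 0 < c ^ (s - 2) := Real.rpow_pos_of_pos hc _
  have hq1 : 0 < c ^ (s - 1) := Real.rpow_pos_of_pos hc _
  have h1' := h1.trans (mul_le_mul_of_nonneg_left hx2 (by positivity))
  have h2' := h2.trans (mul_le_mul_of_nonneg_left hy2 (by positivity))
  have m1 : max (c - 2 * β - r ^ 2) 0 = c + (-2 * β - r ^ 2) := by
    rw [max_eq_left] <;> nlinarith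
  have m2 : max (c + 2 * β - r ^ 2) 0 = c + (2 * β - r ^ 2) := by
    rw [max_eq_left] <;> nlinarith
  rw [chordDiff, m1, m2]
  rw [abs_le] at h1' h2' ⊢
  have : 0 ≤ s * c ^ (s - 1) * r ^ 2 := by positivity
  constructor <;> nlinarith

theorem abs_chordDiff_le_two {s c β r : ℝ} (hs₀ : 0 ≤ s) (hc : 0 ≤ c) (hc₁ : c ≤ 1)
    (h₁ : c - 2 * β - r ^ 2 ≤ 1) (h₂ : c + 2 * β - r ^ 2 ≤ 1) : |chordDiff s c β r| ≤ 2 := by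
  have a1 : (max (c - 2 * β - r ^ 2) 0) ^ s ≤ 1 :=
    Real.rpow_le_one (le_max_right _ _) (max_le h₁ zero_le_one) hs₀
  have a2 : (max (c + 2 * β - r ^ 2) 0) ^ s ≤ 1 :=
    Real.rpow_le_one (le_max_right _ _) (max_le h₂ zero_le_one) hs₀
  have a3 : c ^ s ≤ 1 := Real.rpow_le_one hc hc₁ hs₀
  have b1 : 0 ≤ (max (c - 2 * β - r ^ 2) 0) ^ s := Real.rpow_nonneg (le_max_right _ _) _
  have b2 : 0 ≤ (max (c + 2 * β - r ^ 2) 0) ^ s := Real.rpow_nonneg (le_max_right _ _) _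
  have b3 : 0 ≤ c ^ s := Real.rpow_nonneg hc _
  rw [chordDiff, abs_le]
  constructor <;> linarith

/-! ### The Beta integral and an integration by parts -/

theorem intervalIntegrable_beta {s : ℝ} (hs₀ : 0 < s) (hs₁ : s < 1) :
    IntervalIntegrable (fun x : ℝ => x ^ (-s) * (1 - x) ^ (s - 1)) volume 0 1 := by
  have h := Complex.betaIntegral_convergent (u := ((1 - s : ℝ) : ℂ)) (v := ((s : ℝ) : ℂ))
    (by simpa using hs₁) (by simpa using hs₀)
  rw [intervalIntegrable_iff] at h ⊢
  refine (integrableOn_congr_fun (fun x hx => ?_) measurableSet_uIoc).1 h.re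
  rw [Set.uIoc_of_le zero_le_one] at hx
  have e1 : (x : ℂ) ^ (((1 - s : ℝ) : ℂ) - 1) = ((x ^ (-s) : ℝ) : ℂ) := by
    rw [Complex.ofReal_cpow hx.1.le]; congr 1; push_cast; ring
  have e2 : (1 - (x : ℂ)) ^ (((s : ℝ) : ℂ) - 1) = (((1 - x) ^ (s - 1) : ℝ) : ℂ) := by
    rw [Complex.ofReal_cpow (by linarith [hx.2])]; push_cast; rfl
  simp only [e1, e2]
  rw [← Complex.ofReal_mul]; simp

theorem integral_beta {s : ℝ} (hs₀ : 0 < s) (hs₁ : s < 1) :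
    ∫ x in (0 : ℝ)..1, x ^ (-s) * (1 - x) ^ (s - 1) = ProbabilityTheory.beta s (1 - s) := by
  have h : ProbabilityTheory.beta s (1 - s) = ProbabilityTheory.beta (1 - s) s := by
    simp only [ProbabilityTheory.beta]; rw [mul_comm, add_comm]
  rw [h, ProbabilityTheory.beta_eq_betaIntegralReal _ _ (by linarith) hs₀, Complex.betaIntegral,
    ← Complex.ofReal_re (∫ x in (0 : ℝ)..1, x ^ (-s) * (1 - x) ^ (s - 1)),
    ← intervalIntegral.integral_ofReal]
  congr 1
  refine intervalIntegral.integral_congr fun x hx => ?_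
  rw [Set.uIcc_of_le zero_le_one] at hx
  rw [Complex.ofReal_mul, Complex.ofReal_cpow hx.1, Complex.ofReal_cpow (by linarith [hx.2])]
  push_cast
  congr 2
  ring

/-- Integration by parts against `-x^(-s)/s`. The boundary term at `1` vanishes since `s > 0`, and
the new singularity `(1-x)^(s-1)` is integrable. -/
theorem integral_one_sub_rpow_mul_rpow {s a : ℝ} (hs₀ : 0 < s) (ha₀ : 0 < a) (ha₁ : a < 1) :
    ∫ x in a..1, (1 - x) ^ s * x ^ (-1 - s) =
      a ^ (-s) * (1 - a) ^ s / s - ∫ x in a..1, x ^ (-s) * (1 - x) ^ (s - 1) := by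
  have hpos : ∀ x ∈ Set.uIcc a 1, 0 < x := fun x hx => by
    rw [Set.uIcc_of_le ha₁.le] at hx; linarith [hx.1]
  have hi : IntervalIntegrable (fun x : ℝ => (1 - x) ^ (s - 1)) volume a 1 := by
    have := (intervalIntegral.intervalIntegrable_rpow' (a := 0) (b := 1 - a) (r := s - 1)
      (by linarith)).comp_sub_left 1
    simpa using this.symm
  have := intervalIntegral.integral_mul_deriv_eq_deriv_mul_of_hasDerivAt (a := a) (b := 1)
    (u := fun x : ℝ => (1 - x) ^ s) (v := fun x : ℝ => -x ^ (-s) / s)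
    (u' := fun x => -s * (1 - x) ^ (s - 1)) (v' := fun x => x ^ (-1 - s))
    (ContinuousOn.rpow_const (by fun_prop) fun x _ => Or.inr hs₀.le)
    (by
      exact (ContinuousOn.rpow_const (by fun_prop)
        fun x hx => Or.inl (hpos x hx).ne').neg.div_const _)
    (fun x hx => by
      rw [min_eq_left ha₁.le, max_eq_right ha₁.le] at hx
      have := ((hasDerivAt_id' x).const_sub 1).rpow_const (p := s)
        (Or.inl (by linarith [hx.2]))
      exact this.congr_deriv (by ring))
    (fun x hx => by
      rw [min_eq_left ha₁.le, max_eq_right ha₁.le] at hx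
      have := ((hasDerivAt_id' x).rpow_const (p := -s)
        (Or.inl (by linarith [hx.1]))).neg.div_const s
      refine this.congr_deriv ?_
      rw [show -1 - s = -s - 1 by ring]
      field_simp)
    (hi.const_mul _)
    (ContinuousOn.intervalIntegrable
      (ContinuousOn.rpow_const (by fun_prop) fun x hx => Or.inl (hpos x hx).ne'))
  rw [this, sub_self, Real.zero_rpow hs₀.ne']
  have e : ∫ x in a..1, -s * (1 - x) ^ (s - 1) * (-x ^ (-s) / s) =
      ∫ x in a..1, x ^ (-s) * (1 - x) ^ (s - 1) := by
    congr 1; ext x; field_simp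
  rw [e]
  ring

/-! ### The substitution along a ray of a chord -/

theorem chord_denom_pos {c b r : ℝ} (hr : 0 < r) (h : 0 ≤ c - 2 * b * r - r ^ 2) :
    0 < c - 2 * b * r := by
  nlinarith [sq_pos_of_pos hr]

theorem one_sub_div_rpow_mul_div_rpow_neg {s q r : ℝ} (hr : 0 < r) (hq : 0 < q)
    (h : 0 ≤ q - r ^ 2) :
    (1 - r ^ 2 / q) ^ s * (r ^ 2 / q) ^ (-s) = (q - r ^ 2) ^ s * r ^ (-(2 * s)) := by
  rw [one_sub_div hq.ne', Real.div_rpow h hq.le, Real.div_rpow (by positivity) hq.le,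
    Real.rpow_neg hq.le, ← Real.rpow_natCast r 2, ← Real.rpow_mul hr.le,
    show ((2 : ℕ) : ℝ) * -s = -(2 * s) by push_cast; ring]
  have : 0 < q ^ s := Real.rpow_pos_of_pos hq _
  field_simp

/-- Here `q = c - 2br` and `k = c - br`: for `x = r²/q`, `rk/q` is `√(b²x² + cx)` and `2rk/q²` is
`dx/dr`, so this expresses `dr/r` through `dx`. -/
theorem chord_jacobian {b q k r : ℝ} (hr : r ≠ 0) (hq : q ≠ 0) (hk : k ≠ 0) (h : k - b * r = q) :
    (1 / (2 * (r ^ 2 / q)) - b / (2 * (r * k / q))) * (2 * r * k / q ^ 2) = r⁻¹ := by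
  field_simp
  linarith

/-- The substitution `x = r² / (c - 2br)` on a chord of the ball. -/
theorem integral_chord_subst {s c b δ R : ℝ} (hs₀ : 0 < s) (hc : 0 < c) (hδ : 0 < δ)
    (hδR : δ ≤ R) (hR : c - 2 * b * R - R ^ 2 = 0) :
    ∫ r in δ..R, (c - 2 * b * r - r ^ 2) ^ s * r ^ (-1 - 2 * s) =
      ∫ x in δ ^ 2 / (c - 2 * b * δ)..1,
        (1 - x) ^ s * x ^ (-s) * (1 / (2 * x) - b / (2 * √(b ^ 2 * x ^ 2 + c * x))) := by
  have hquad : ∀ r ∈ Set.uIcc δ R, 0 < r ∧ 0 ≤ c - 2 * b * r - r ^ 2 := by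
    intro r hr
    rw [Set.uIcc_of_le hδR] at hr
    refine ⟨by linarith [hr.1], ?_⟩
    have hr0 : 0 < r := by linarith [hr.1]
    have hR0 : 0 < R := by linarith
    -- The roots of the quadratic have product `-c`, so besides `R` the other root is `-c/R`.
    have : 0 ≤ (R - r) * (c + r * R) := mul_nonneg (by linarith [hr.2]) (by positivity)
    have h2 : R * (c - 2 * b * r - r ^ 2) = (R - r) * (c + r * R) := by linear_combination r * hR
    rw [← h2] at this
    exact nonneg_of_mul_nonneg_right this hR0
  have hden : ∀ r ∈ Set.uIcc δ R, 0 < c - 2 * b * r := fun r hr =>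
    chord_denom_pos (hquad r hr).1 (hquad r hr).2
  have hden' : ∀ r ∈ Set.uIcc δ R, 0 < c - b * r := fun r hr => by
    linarith [hden r hr]
  have hRR : R ^ 2 / (c - 2 * b * R) = 1 := by
    rw [div_eq_one_iff_eq (hden R (by simp)).ne']; linarith
  have key := intervalIntegral.integral_comp_mul_deriv' (a := δ) (b := R)
    (f := fun r => r ^ 2 / (c - 2 * b * r))
    (f' := fun r => 2 * r * (c - b * r) / (c - 2 * b * r) ^ 2)
    (g := fun x => (1 - x) ^ s * x ^ (-s) * (1 / (2 * x) - b / (2 * √(b ^ 2 * x ^ 2 + c * x))))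
    (fun r hr => by
      have h1 := (hden r hr).ne'
      have hd : HasDerivAt (fun r : ℝ => c - 2 * b * r) (-(2 * b)) r := by
        simpa using ((hasDerivAt_id' r).const_mul (2 * b)).const_sub c
      refine ((hasDerivAt_pow 2 r).div hd h1).congr_deriv ?_
      field_simp
      push_cast
      ring)
    (by
      refine ContinuousOn.div (by fun_prop) (by fun_prop) fun r hr => ?_
      exact pow_ne_zero _ (hden r hr).ne')
    (by
      have hx : ∀ x ∈ (fun r => r ^ 2 / (c - 2 * b * r)) '' Set.uIcc δ R, 0 < x := by
        rintro x ⟨r, hr, rfl⟩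
        exact div_pos (pow_pos (hquad r hr).1 2) (hden r hr)
      refine ContinuousOn.mul (ContinuousOn.mul ?_ ?_) (ContinuousOn.sub ?_ ?_)
      · exact ContinuousOn.rpow_const (by fun_prop) fun x _ => Or.inr hs₀.le
      · exact ContinuousOn.rpow_const (by fun_prop) fun x h => Or.inl (hx x h).ne'
      · exact ContinuousOn.div (by fun_prop) (by fun_prop) fun x h =>
          mul_ne_zero two_ne_zero (hx x h).ne'
      · refine ContinuousOn.div (by fun_prop) (by fun_prop) fun x h => ?_
        have := hx x h
        positivity)
  simp only [hRR] at key
  rw [← key]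
  refine intervalIntegral.integral_congr fun r hr => ?_
  have h1 := hden r hr
  have h2 := hden' r hr
  obtain ⟨h3, h4⟩ := hquad r hr
  simp only [Function.comp]
  have hD : √(b ^ 2 * (r ^ 2 / (c - 2 * b * r)) ^ 2 + c * (r ^ 2 / (c - 2 * b * r))) =
      r * (c - b * r) / (c - 2 * b * r) := by
    rw [Real.sqrt_eq_iff_mul_self_eq_of_pos (by positivity)]
    field_simp
    ring
  rw [hD, one_sub_div_rpow_mul_div_rpow_neg h3 h1 h4,
    mul_assoc ((c - 2 * b * r - r ^ 2) ^ s * r ^ (-(2 * s))),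
    chord_jacobian h3.ne' h1.ne' h2.ne' (by ring), show -1 - 2 * s = -(2 * s) - 1 by ring,
    Real.rpow_sub_one h3.ne', div_eq_mul_inv, mul_assoc ((c - 2 * b * r - r ^ 2) ^ s)]

/-- The positive endpoint of a chord. -/
theorem exists_chord_end {c : ℝ} (b : ℝ) (hc : 0 < c) :
    ∃ R, 0 < R ∧ c - 2 * b * R - R ^ 2 = 0 := by
  have h : |b| < √(b ^ 2 + c) := by
    rw [← Real.sqrt_sq_eq_abs]; exact Real.sqrt_lt_sqrt (sq_nonneg b) (by linarith)
  refine ⟨√(b ^ 2 + c) - b, by linarith [le_abs_self b], ?_⟩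
  have := Real.sq_sqrt (show 0 ≤ b ^ 2 + c by positivity)
  nlinarith

theorem chord_neg_of_end_lt {c b r R : ℝ} (hc : 0 < c) (hR₀ : 0 < R)
    (hR : c - 2 * b * R - R ^ 2 = 0) (hr : R ≤ r) : c - 2 * b * r - r ^ 2 ≤ 0 := by
  have : (R - r) * (c + r * R) ≤ 0 :=
    mul_nonpos_of_nonpos_of_nonneg (by linarith) (by nlinarith)
  have h2 : R * (c - 2 * b * r - r ^ 2) = (R - r) * (c + r * R) := by linear_combination r * hR
  rw [← h2] at this
  exact nonpos_of_mul_nonpos_right this hR₀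

theorem chord_pos_of_lt_end {c b r R : ℝ} (hc : 0 < c) (hr₀ : 0 < r)
    (hR : c - 2 * b * R - R ^ 2 = 0) (hr : r < R) : 0 < c - 2 * b * r - r ^ 2 := by
  have : 0 < (R - r) * (c + r * R) := mul_pos (by linarith) (by nlinarith [mul_pos hr₀ (hr₀.trans hr)])
  have h2 : R * (c - 2 * b * r - r ^ 2) = (R - r) * (c + r * R) := by linear_combination r * hR
  rw [← h2] at this
  exact pos_of_mul_pos_right this (hr₀.trans hr).le

/-- Integral of one ray of the chord, in the variable `x = r² / (c - 2br)`. -/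
theorem integral_Ioi_chord {s c b δ : ℝ} (hs₀ : 0 < s) (hc : 0 < c) (hδ : 0 < δ)
    (h : 0 < c - 2 * b * δ - δ ^ 2) :
    ∫ r in Set.Ioi δ, (max (c - 2 * b * r - r ^ 2) 0) ^ s * r ^ (-1 - 2 * s) =
      δ ^ (-(2 * s)) * (c - 2 * b * δ - δ ^ 2) ^ s / (2 * s)
        - (∫ x in δ ^ 2 / (c - 2 * b * δ)..1, x ^ (-s) * (1 - x) ^ (s - 1)) / 2
        - b / 2 * ∫ x in δ ^ 2 / (c - 2 * b * δ)..1,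
            (1 - x) ^ s * x ^ (-s) / √(b ^ 2 * x ^ 2 + c * x) := by
  obtain ⟨R, hR₀, hR⟩ := exists_chord_end b hc
  have hδR : δ < R := by
    by_contra hcon
    linarith [chord_neg_of_end_lt hc hR₀ hR (not_lt.1 hcon)]
  have hden := chord_denom_pos hδ h.le
  set a := δ ^ 2 / (c - 2 * b * δ) with ha
  have ha₀ : 0 < a := by positivity
  have ha₁ : a < 1 := by rw [ha, div_lt_one hden]; linarith
  have hax : ∀ x ∈ Set.uIcc a 1, 0 < x := fun x hx => by
    rw [Set.uIcc_of_le ha₁.le] at hx; linarith [hx.1]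
  have e1 : ∫ r in Set.Ioi δ, (max (c - 2 * b * r - r ^ 2) 0) ^ s * r ^ (-1 - 2 * s) =
      ∫ r in δ..R, (c - 2 * b * r - r ^ 2) ^ s * r ^ (-1 - 2 * s) := by
    rw [intervalIntegral.integral_of_le hδR.le,
      setIntegral_eq_of_subset_of_forall_sdiff_eq_zero measurableSet_Ioi
        (s := Set.Ioc δ R) (fun r hr => hr.1)]
    · refine setIntegral_congr_fun measurableSet_Ioc fun r hr => ?_
      have : 0 ≤ c - 2 * b * r - r ^ 2 := by
        rcases hr.2.eq_or_lt with rfl | h'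
        · exact hR.ge
        · exact (chord_pos_of_lt_end hc (hδ.trans hr.1) hR h').le
      simp only [max_eq_left this]
    · rintro r ⟨hr1, hr2⟩
      have hRr : R ≤ r := by
        by_contra hcon
        exact hr2 ⟨hr1, (not_le.1 hcon).le⟩
      rw [max_eq_right (chord_neg_of_end_lt hc hR₀ hR hRr), Real.zero_rpow hs₀.ne', zero_mul]
  have c1 : ContinuousOn (fun x : ℝ => (1 - x) ^ s) (Set.uIcc a 1) :=
    ContinuousOn.rpow_const (by fun_prop) fun x _ => Or.inr hs₀.le
  have c2 : ∀ p : ℝ, ContinuousOn (fun x : ℝ => x ^ p) (Set.uIcc a 1) := fun p =>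
    ContinuousOn.rpow_const (by fun_prop) fun x h => Or.inl (hax x h).ne'
  have c4 : ContinuousOn (fun x : ℝ => (1 - x) ^ s * x ^ (-1 - s)) (Set.uIcc a 1) := c1.mul (c2 _)
  have c3 : ContinuousOn (fun x : ℝ => (1 - x) ^ s * x ^ (-s) / √(b ^ 2 * x ^ 2 + c * x))
      (Set.uIcc a 1) := by
    refine ContinuousOn.div (c1.mul (c2 _)) (by fun_prop) fun x h => ?_
    have := hax x h
    positivity
  -- Separates the integrand independent of `b`, which is then integrated by parts, from the one
  -- carrying the odd factor `b`.
  have e2 : ∫ x in a..1,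
        (1 - x) ^ s * x ^ (-s) * (1 / (2 * x) - b / (2 * √(b ^ 2 * x ^ 2 + c * x))) =
      ∫ x in a..1, (1 / 2 * ((1 - x) ^ s * x ^ (-1 - s)) -
        b / 2 * ((1 - x) ^ s * x ^ (-s) / √(b ^ 2 * x ^ 2 + c * x))) := by
    refine intervalIntegral.integral_congr fun x hx => ?_
    rw [show -1 - s = -s - 1 by ring, Real.rpow_sub_one (hax x hx).ne']
    ring
  rw [e1, integral_chord_subst hs₀ hc hδ hδR.le hR, ← ha, e2, intervalIntegral.integral_sub
    (c4.intervalIntegrable.const_mul _) (c3.intervalIntegrable.const_mul _),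
    intervalIntegral.integral_const_mul, intervalIntegral.integral_const_mul,
    integral_one_sub_rpow_mul_rpow hs₀ ha₀ ha₁]
  have hxs : a ^ (-s) * (1 - a) ^ s = δ ^ (-(2 * s)) * (c - 2 * b * δ - δ ^ 2) ^ s := by
    rw [mul_comm, ha, one_sub_div_rpow_mul_div_rpow_neg hδ hden h.le, mul_comm]
  rw [hxs]
  ring

theorem integrableOn_Ioi_chord {s c δ : ℝ} (b : ℝ) (hs₀ : 0 < s) (hc : 0 < c) (hδ : 0 < δ) :
    IntegrableOn (fun r : ℝ => (max (c - 2 * b * r - r ^ 2) 0) ^ s * r ^ (-1 - 2 * s))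
      (Set.Ioi δ) := by
  have h := integrableOn_Ioi_rpow_of_lt (a := -1 - 2 * s) (by linarith) hδ
  -- Completing the square, the quadratic is `c + b² - (b + r)²`.
  refine Integrable.bdd_mul (c := (c + b ^ 2) ^ s) h ?_ ?_
  · refine Continuous.aestronglyMeasurable ?_
    exact Continuous.rpow_const (by fun_prop) fun r => Or.inr hs₀.le
  · refine Eventually.of_forall fun r => ?_
    rw [Real.norm_of_nonneg (Real.rpow_nonneg (le_max_right _ _) _)]
    refine Real.rpow_le_rpow (le_max_right _ _) (max_le ?_ (by positivity)) hs₀.le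
    nlinarith [sq_nonneg (b + r)]

/-! ### Removing the cutoff on a chord -/

theorem tendsto_rpow_nhdsGT_zero {p : ℝ} (hp : 0 < p) :
    Tendsto (fun δ : ℝ => δ ^ p) (𝓝[>] 0) (𝓝 0) := by
  have := (Real.continuousAt_rpow_const 0 p (Or.inr hp.le)).tendsto
  rw [Real.zero_rpow hp.ne'] at this
  exact this.mono_left nhdsWithin_le_nhds

theorem tendsto_integral_beta {s : ℝ} (hs₀ : 0 < s) (hs₁ : s < 1) :
    Tendsto (fun a : ℝ => ∫ x in a..1, x ^ (-s) * (1 - x) ^ (s - 1)) (𝓝[>] 0)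
      (𝓝 (ProbabilityTheory.beta s (1 - s))) := by
  have h := intervalIntegrable_beta hs₀ hs₁
  have hc := intervalIntegral.continuousOn_primitive_interval_left (a := 0) (b := 1)
    (f := fun x : ℝ => x ^ (-s) * (1 - x) ^ (s - 1)) (μ := volume)
    ((intervalIntegrable_iff' (by simp)).1 h)
  have h0 := hc 0 (by simp)
  rw [ContinuousWithinAt, integral_beta hs₀ hs₁, Set.uIcc_of_le zero_le_one] at h0
  refine h0.mono_left ?_
  rw [← nhdsWithin_Ioc_eq_nhdsGT (zero_lt_one (α := ℝ))]
  exact nhdsWithin_mono _ Set.Ioc_subset_Icc_self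

/-- The divergent `δ^(-2s)` contributions of the two rays and of the constant `2c^s` meet in a
single second difference at `δ`, which is small enough to absorb the divergence. -/
theorem integral_Ioi_chordDiff {s c b δ : ℝ} (hs₀ : 0 < s) (hc : 0 < c) (hδ : 0 < δ)
    (h₁ : 0 < c - 2 * b * δ - δ ^ 2) (h₂ : 0 < c - 2 * (-b) * δ - δ ^ 2) :
    ∫ r in Set.Ioi δ, chordDiff s c (b * r) r * r ^ (-1 - 2 * s) =
      chordDiff s c (b * δ) δ * δ ^ (-(2 * s)) / (2 * s)
        + ((∫ x in δ ^ 2 / (c - 2 * b * δ)..1, x ^ (-s) * (1 - x) ^ (s - 1))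
          + ∫ x in δ ^ 2 / (c - 2 * (-b) * δ)..1, x ^ (-s) * (1 - x) ^ (s - 1)) / 2
        + b / 2 * ((∫ x in δ ^ 2 / (c - 2 * b * δ)..1,
            (1 - x) ^ s * x ^ (-s) / √(b ^ 2 * x ^ 2 + c * x))
          - ∫ x in δ ^ 2 / (c - 2 * (-b) * δ)..1,
            (1 - x) ^ s * x ^ (-s) / √(b ^ 2 * x ^ 2 + c * x)) := by
  have i0 := (integrableOn_Ioi_rpow_of_lt (a := -1 - 2 * s) (by linarith) hδ).const_mul (2 * c ^ s)
  have i1 := integrableOn_Ioi_chord b hs₀ hc hδ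
  have i2 := integrableOn_Ioi_chord (-b) hs₀ hc hδ
  have e : ∀ r : ℝ, chordDiff s c (b * r) r * r ^ (-1 - 2 * s) =
      2 * c ^ s * r ^ (-1 - 2 * s) - (max (c - 2 * b * r - r ^ 2) 0) ^ s * r ^ (-1 - 2 * s)
        - (max (c - 2 * (-b) * r - r ^ 2) 0) ^ s * r ^ (-1 - 2 * s) := fun r => by
    rw [chordDiff, show c - 2 * (b * r) - r ^ 2 = c - 2 * b * r - r ^ 2 by ring,
      show c + 2 * (b * r) - r ^ 2 = c - 2 * (-b) * r - r ^ 2 by ring]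
    ring
  have i01 : IntegrableOn (fun r : ℝ => 2 * c ^ s * r ^ (-1 - 2 * s) -
      (max (c - 2 * b * r - r ^ 2) 0) ^ s * r ^ (-1 - 2 * s)) (Set.Ioi δ) := i0.sub i1
  simp_rw [e]
  rw [integral_sub i01 i2, integral_sub i0 i1, integral_const_mul,
    integral_Ioi_rpow_of_lt (by linarith) hδ, integral_Ioi_chord hs₀ hc hδ h₁,
    integral_Ioi_chord hs₀ hc hδ h₂, chordDiff,
    show c - 2 * (b * δ) - δ ^ 2 = c - 2 * b * δ - δ ^ 2 by ring,
    show c + 2 * (b * δ) - δ ^ 2 = c - 2 * (-b) * δ - δ ^ 2 by ring, max_eq_left h₁.le,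
    max_eq_left h₂.le, show -1 - 2 * s + 1 = -(2 * s) by ring, neg_sq]
  field_simp
  ring

/-- The integrand is the same for `b` and `-b`, so only the interval between the two lower limits
survives: its length is `O(δ³)`, and the integrand there is `O(δ^(-1-2s))`. -/
theorem abs_integral_odd_part_le {s c b δ : ℝ} (hs₀ : 0 < s) (hc : 0 < c) (hb : |b| ≤ 1)
    (hδ : 0 < δ) (hδc : 4 * δ ≤ c) (hc₁ : c ≤ 1) :
    |(∫ x in δ ^ 2 / (c - 2 * b * δ)..1, (1 - x) ^ s * x ^ (-s) / √(b ^ 2 * x ^ 2 + c * x))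
      - ∫ x in δ ^ 2 / (c - 2 * (-b) * δ)..1,
          (1 - x) ^ s * x ^ (-s) / √(b ^ 2 * x ^ 2 + c * x)| ≤
      (2 * c) ^ s * √2 * 16 / c ^ 2 * δ ^ (2 - 2 * s) := by
  obtain ⟨hb1, hb2⟩ := abs_le.1 hb
  have q1 : c / 2 ≤ c - 2 * b * δ := by nlinarith
  have q2 : c / 2 ≤ c - 2 * (-b) * δ := by nlinarith
  have q1' : c - 2 * b * δ ≤ 2 * c := by nlinarith
  have q2' : c - 2 * (-b) * δ ≤ 2 * c := by nlinarith
  have p1 : 0 < c - 2 * b * δ := by linarith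
  have p2 : 0 < c - 2 * (-b) * δ := by linarith
  set a₁ := δ ^ 2 / (c - 2 * b * δ) with ha₁
  set a₂ := δ ^ 2 / (c - 2 * (-b) * δ) with ha₂
  -- A common lower bound for both limits, keeping the integrand away from its singularity at `0`.
  set m := δ ^ 2 / (2 * c) with hm
  have hm0 : 0 < m := by positivity
  have hma₁ : m ≤ a₁ := div_le_div_of_nonneg_left (by positivity) p1 q1'
  have hma₂ : m ≤ a₂ := div_le_div_of_nonneg_left (by positivity) p2 q2'
  have ha₁1 : a₁ ≤ 1 := by rw [ha₁, div_le_one p1]; nlinarith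
  have ha₂1 : a₂ ≤ 1 := by rw [ha₂, div_le_one p2]; nlinarith
  have hint : ∀ a, m ≤ a → a ≤ 1 → IntervalIntegrable
      (fun x : ℝ => (1 - x) ^ s * x ^ (-s) / √(b ^ 2 * x ^ 2 + c * x)) volume a 1 := by
    intro a hma ha
    have hx : ∀ x ∈ Set.uIcc a 1, 0 < x := fun x hx => by
      rw [Set.uIcc_of_le ha] at hx; linarith [hx.1]
    refine ContinuousOn.intervalIntegrable (ContinuousOn.div (ContinuousOn.mul
      (ContinuousOn.rpow_const (by fun_prop) fun x _ => Or.inr hs₀.le)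
      (ContinuousOn.rpow_const (by fun_prop) fun x h => Or.inl (hx x h).ne')) (by fun_prop)
      fun x h => ?_)
    have := hx x h
    positivity
  rw [intervalIntegral.integral_interval_sub_interval_comm' (hint a₁ hma₁ ha₁1)
    (hint a₂ hma₂ ha₂1) ((hint a₁ hma₁ ha₁1).trans (hint a₂ hma₂ ha₂1).symm),
    intervalIntegral.integral_same, zero_sub, abs_neg]
  have hb := intervalIntegral.norm_integral_le_of_norm_le_const (a := a₂) (b := a₁)
    (f := fun x : ℝ => (1 - x) ^ s * x ^ (-s) / √(b ^ 2 * x ^ 2 + c * x))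
    (C := m ^ (-s) / √(c * m)) (fun x hx => by
      have hmx : m ≤ x := (le_min hma₂ hma₁).trans hx.1.le
      have hx1 : x ≤ 1 := hx.2.trans (max_le ha₂1 ha₁1)
      have hx0 : 0 < x := by linarith
      rw [Real.norm_of_nonneg (div_nonneg (mul_nonneg (Real.rpow_nonneg (by linarith) _)
        (Real.rpow_nonneg hx0.le _)) (Real.sqrt_nonneg _))]
      have t1 : (1 - x) ^ s ≤ 1 := Real.rpow_le_one (by linarith) (by linarith) hs₀.le
      have t2 : x ^ (-s) ≤ m ^ (-s) := Real.rpow_le_rpow_of_nonpos hm0 hmx (by linarith)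
      have t3 : √(c * m) ≤ √(b ^ 2 * x ^ 2 + c * x) := by
        refine Real.sqrt_le_sqrt ?_
        nlinarith [sq_nonneg (b * x)]
      have t4 : 0 < √(c * m) := by positivity
      have t5 : 0 ≤ x ^ (-s) := Real.rpow_nonneg hx0.le _
      refine div_le_div₀ (Real.rpow_nonneg hm0.le _) ?_ t4 t3
      nlinarith)
  rw [Real.norm_eq_abs] at hb
  -- The numerator of the difference is `4bδ³` and both denominators are at least `c/2`, whence
  -- `16`.
  have hd : |a₁ - a₂| ≤ δ ^ 3 * 16 / c ^ 2 := by
    have : a₁ - a₂ = δ ^ 3 * (4 * b) / ((c - 2 * b * δ) * (c - 2 * (-b) * δ)) := by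
      rw [ha₁, ha₂, div_sub_div _ _ p1.ne' p2.ne']
      ring
    rw [this, abs_div, abs_of_pos (mul_pos p1 p2), abs_mul, abs_of_pos (pow_pos hδ 3),
      abs_mul, abs_of_pos (by norm_num : (0 : ℝ) < 4), div_le_div_iff₀ (mul_pos p1 p2) (by positivity)]
    have hq : c ^ 2 / 4 ≤ (c - 2 * b * δ) * (c - 2 * (-b) * δ) := by
      calc c ^ 2 / 4 = c / 2 * (c / 2) := by ring
        _ ≤ _ := mul_le_mul q1 q2 (by positivity) p1.le
    calc δ ^ 3 * (4 * |b|) * c ^ 2 ≤ δ ^ 3 * (4 * 1) * c ^ 2 := by gcongr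
      _ = δ ^ 3 * 16 * (c ^ 2 / 4) := by ring
      _ ≤ _ := by gcongr
  have hms : m ^ (-s) = (2 * c) ^ s * δ ^ (-(2 * s)) := by
    rw [hm, Real.div_rpow (by positivity) (by positivity), Real.rpow_neg (by positivity : 0 ≤ 2 * c),
      ← Real.rpow_natCast δ 2, ← Real.rpow_mul hδ.le, div_inv_eq_mul, mul_comm]
    congr 2
    push_cast
    ring
  have hsq : √(c * m) = δ / √2 := by
    rw [hm, show c * (δ ^ 2 / (2 * c)) = δ ^ 2 / 2 by field_simp,
      Real.sqrt_div (by positivity), Real.sqrt_sq hδ.le]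
  refine (hb.trans (mul_le_mul_of_nonneg_left hd (by positivity))).trans_eq ?_
  rw [hms, hsq, show 2 - 2 * s = 2 + -(2 * s) by ring, Real.rpow_add hδ, Real.rpow_two]
  field_simp

/-- The symmetric second difference of `𝒰` along any chord has the same weighted integral. -/
theorem tendsto_integral_Ioi_chordDiff {s c b : ℝ} (hs₀ : 0 < s) (hs₁ : s < 1) (hc : 0 < c)
    (hc₁ : c ≤ 1) (hb : |b| ≤ 1) :
    Tendsto (fun δ : ℝ => ∫ r in Set.Ioi δ, chordDiff s c (b * r) r * r ^ (-1 - 2 * s)) (𝓝[>] 0)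
      (𝓝 (ProbabilityTheory.beta s (1 - s))) := by
  -- The range required by `chordDiff_le`; it also keeps both endpoints inside the ball and ensures
  -- `4δ ≤ c`.
  have hev : ∀ᶠ δ : ℝ in 𝓝[>] 0, 0 < δ ∧ δ < c / 6 :=
    Ioo_mem_nhdsGT (by positivity)
  have hquad : ∀ b' : ℝ, |b'| ≤ 1 → ∀ δ : ℝ, 0 < δ → δ < c / 6 →
      0 < c - 2 * b' * δ - δ ^ 2 := fun b' hb' δ h1 h2 => by
    nlinarith [(abs_le.1 hb').2]
  have hb' : |-b| ≤ 1 := by rwa [abs_neg]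
  have ht : ∀ b' : ℝ, |b'| ≤ 1 →
      Tendsto (fun δ : ℝ => δ ^ 2 / (c - 2 * b' * δ)) (𝓝[>] 0) (𝓝[>] 0) := by
    intro b' hb'
    refine tendsto_nhdsWithin_iff.2 ⟨?_, ?_⟩
    · have : ContinuousAt (fun δ : ℝ => δ ^ 2 / (c - 2 * b' * δ)) 0 :=
        ContinuousAt.div (by fun_prop) (by fun_prop) (by simpa using hc.ne')
      have h := this.tendsto
      simp only [ne_eq, OfNat.ofNat_ne_zero, not_false_eq_true, zero_pow, zero_div] at h
      exact h.mono_left nhdsWithin_le_nhds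
    · filter_upwards [hev] with δ hδ
      exact div_pos (pow_pos hδ.1 2)
        (chord_denom_pos hδ.1 (hquad b' hb' δ hδ.1 hδ.2).le)
  have l1 : Tendsto (fun δ : ℝ => chordDiff s c (b * δ) δ * δ ^ (-(2 * s)) / (2 * s)) (𝓝[>] 0)
      (𝓝 0) := by
    have hp := (tendsto_rpow_nhdsGT_zero (p := 2 - 2 * s) (by linarith)).const_mul
      ((2 * s * c ^ (s - 1) + 36 * c ^ (s - 2)) / (2 * s))
    rw [mul_zero] at hp
    refine squeeze_zero_norm' ?_ hp
    filter_upwards [hev] with δ hδ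
    have h1 := chordDiff_le hs₀.le hs₁.le hc hc₁ (β := b * δ) (r := δ)
      (by rw [abs_mul, abs_of_pos hδ.1]; nlinarith [hδ.1]) hδ.2.le
    have h2 : 0 < δ ^ (-(2 * s)) := Real.rpow_pos_of_pos hδ.1 _
    rw [Real.norm_eq_abs, abs_div, abs_mul, abs_of_pos h2, abs_of_pos (by positivity : 0 < 2 * s),
      show 2 - 2 * s = 2 + -(2 * s) by ring, Real.rpow_add hδ.1, Real.rpow_two, div_mul_eq_mul_div,
      ← mul_assoc]
    gcongr
  have l2 : Tendsto (fun δ : ℝ => b / 2 *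
      ((∫ x in δ ^ 2 / (c - 2 * b * δ)..1, (1 - x) ^ s * x ^ (-s) / √(b ^ 2 * x ^ 2 + c * x))
      - ∫ x in δ ^ 2 / (c - 2 * (-b) * δ)..1,
          (1 - x) ^ s * x ^ (-s) / √(b ^ 2 * x ^ 2 + c * x))) (𝓝[>] 0) (𝓝 0) := by
    refine (Tendsto.const_mul (b / 2) (a := 0) ?_).mono_right (by rw [mul_zero])
    have hp := (tendsto_rpow_nhdsGT_zero (p := 2 - 2 * s) (by linarith)).const_mul
      ((2 * c) ^ s * √2 * 16 / c ^ 2)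
    rw [mul_zero] at hp
    refine squeeze_zero_norm' ?_ hp
    filter_upwards [hev] with δ hδ
    exact abs_integral_odd_part_le hs₀ hc hb hδ.1 (by linarith [hδ.2]) hc₁
  have l3 := (((tendsto_integral_beta hs₀ hs₁).comp (ht b hb)).add
    ((tendsto_integral_beta hs₀ hs₁).comp (ht (-b) hb'))).div_const 2
  have l := (l1.add l3).add l2
  rw [zero_add, add_zero, add_self_div_two] at l
  refine l.congr' ?_
  filter_upwards [hev] with δ hδ
  exact (integral_Ioi_chordDiff hs₀ hc hδ.1 (hquad b hb δ hδ.1 hδ.2)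
    (hquad (-b) hb' δ hδ.1 hδ.2)).symm

/-! ### Integrability against the kernel and polar coordinates -/

theorem integrableOn_Ioi_truncated_sq_mul_rpow {s ρ : ℝ} (C M : ℝ) (hs₀ : 0 < s) (hs₁ : s < 1)
    (hρ : 0 < ρ) :
    IntegrableOn (fun r : ℝ => (if r ≤ ρ then C * r ^ 2 else M) * r ^ (-1 - 2 * s))
      (Set.Ioi 0) := by
  rw [← Set.Ioc_union_Ioi_eq_Ioi hρ.le]
  refine IntegrableOn.union ?_ ?_
  · have h : IntegrableOn (fun r : ℝ => r ^ (1 - 2 * s)) (Set.Ioc 0 ρ) :=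
      (intervalIntegrable_iff_integrableOn_Ioc_of_le hρ.le).1
        (intervalIntegral.intervalIntegrable_rpow' (by linarith))
    refine (integrableOn_congr_fun (fun r hr => ?_) measurableSet_Ioc).1 (h.const_mul C)
    simp only [if_pos hr.2]
    rw [show 1 - 2 * s = 2 + (-1 - 2 * s) by ring, Real.rpow_add hr.1, Real.rpow_two]
    ring
  · refine (integrableOn_congr_fun (fun r hr => ?_) measurableSet_Ioi).1
      ((integrableOn_Ioi_rpow_of_lt (a := -1 - 2 * s) (by linarith) hρ).const_mul M)
    simp only [if_neg (not_le.2 (Set.mem_Ioi.1 hr))]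

theorem pow_mul_div_rpow {n : ℕ} (hn : n ≠ 0) {r s : ℝ} (a : ℝ) (hr : 0 < r) :
    r ^ (n - 1) * (a / r ^ ((n : ℝ) + 2 * s)) = a * r ^ (-1 - 2 * s) := by
  have h1 : r ^ (n - 1) = r ^ ((n : ℝ) - 1) := by
    rw [← Real.rpow_natCast, Nat.cast_sub (Nat.one_le_iff_ne_zero.2 hn), Nat.cast_one]
  rw [h1, show -1 - 2 * s = ((n : ℝ) - 1) - ((n : ℝ) + 2 * s) by ring, Real.rpow_sub hr (_ - 1)]
  ring

variable {n : ℕ}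

/-- A bounded function vanishing to second order at the origin is integrable against
`|y|^{-n-2s}`. -/
theorem integrable_div_norm_rpow [NeZero n] {s C M ρ : ℝ} (hs₀ : 0 < s) (hs₁ : s < 1)
    (hρ : 0 < ρ) {f : EuclideanSpace ℝ (Fin n) → ℝ} (hf : AEStronglyMeasurable f)
    (h₁ : ∀ y, ‖y‖ ≤ ρ → |f y| ≤ C * ‖y‖ ^ 2) (h₂ : ∀ y, |f y| ≤ M) :
    Integrable fun y => f y / ‖y‖ ^ ((n : ℝ) + 2 * s) := by
  have hg : Integrable fun y : EuclideanSpace ℝ (Fin n) =>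
      (fun r : ℝ => (if r ≤ ρ then C * r ^ 2 else M) / r ^ ((n : ℝ) + 2 * s)) ‖y‖ := by
    refine (integrable_fun_norm_addHaar (volume : Measure (EuclideanSpace ℝ (Fin n)))
      (f := fun r : ℝ => (if r ≤ ρ then C * r ^ 2 else M) / r ^ ((n : ℝ) + 2 * s))).2 ?_
    refine (integrableOn_congr_fun (fun r hr => ?_) measurableSet_Ioi).1
      (integrableOn_Ioi_truncated_sq_mul_rpow C M hs₀ hs₁ hρ)
    simp only [finrank_euclideanSpace, Fintype.card_fin, smul_eq_mul]
    rw [pow_mul_div_rpow (NeZero.ne n) _ hr]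
  refine hg.mono' (AEStronglyMeasurable.div₀ hf ?_) (Eventually.of_forall fun y => ?_)
  · exact (measurable_norm.pow_const _).aestronglyMeasurable
  · have hp : 0 ≤ ‖y‖ ^ ((n : ℝ) + 2 * s) := Real.rpow_nonneg (norm_nonneg _) _
    rw [Real.norm_eq_abs, abs_div, abs_of_nonneg hp]
    refine div_le_div_of_nonneg_right ?_ hp
    split_ifs with h
    · exact h₁ y h
    · exact h₂ y

/-- Integration in polar coordinates. -/
theorem integral_polar [NeZero n] {f : EuclideanSpace ℝ (Fin n) → ℝ} (hf : Integrable f) :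
    ∫ y, f y = ∫ θ : Metric.sphere (0 : EuclideanSpace ℝ (Fin n)) 1,
      ∫ r in Set.Ioi (0 : ℝ), r ^ (n - 1) * f (r • (θ : EuclideanSpace ℝ (Fin n)))
        ∂volume ∂(volume : Measure (EuclideanSpace ℝ (Fin n))).toSphere := by
  set μ := (volume : Measure (EuclideanSpace ℝ (Fin n))) with hμ
  have hdim : Module.finrank ℝ (EuclideanSpace ℝ (Fin n)) = n := by simp
  have hmp := μ.measurePreserving_homeomorphUnitSphereProd
  have hemb := (homeomorphUnitSphereProd (EuclideanSpace ℝ (Fin n))).measurableEmbedding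
  set g : Metric.sphere (0 : EuclideanSpace ℝ (Fin n)) 1 × Set.Ioi (0 : ℝ) → ℝ :=
    fun p => f ((p.2 : ℝ) • (p.1 : EuclideanSpace ℝ (Fin n))) with hgdef
  have hg : ∀ y : ({0}ᶜ : Set (EuclideanSpace ℝ (Fin n))),
      g (homeomorphUnitSphereProd _ y) = f y := fun y => by
    have : ‖(y : EuclideanSpace ℝ (Fin n))‖ ≠ 0 := norm_ne_zero_iff.2 y.2
    simp [hgdef, smul_smul, this]
  have hgi : Integrable g (μ.toSphere.prod
      (.volumeIoiPow (Module.finrank ℝ (EuclideanSpace ℝ (Fin n)) - 1))) := by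
    rw [← hmp.integrable_comp_emb hemb]
    have : g ∘ homeomorphUnitSphereProd (EuclideanSpace ℝ (Fin n)) = f ∘ Subtype.val :=
      funext hg
    rw [this, ← integrableOn_iff_comap_subtypeVal (by measurability)]
    exact hf.integrableOn
  calc ∫ y, f y ∂μ = ∫ y : ({0}ᶜ : Set (EuclideanSpace ℝ (Fin n))), f y ∂(μ.comap (↑)) := by
        rw [integral_subtype_comap (measurableSet_singleton _).compl f,
          restrict_compl_singleton]
    _ = ∫ p, g p ∂μ.toSphere.prod
          (.volumeIoiPow (Module.finrank ℝ (EuclideanSpace ℝ (Fin n)) - 1)) := by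
        rw [← hmp.integral_comp hemb]
        simp only [hg]
    _ = _ := by
        rw [integral_prod _ hgi, hdim]
        congr 1
        ext θ
        simp only [Measure.volumeIoiPow, ENNReal.ofReal]
        rw [integral_withDensity_eq_integral_smul,
          integral_subtype_comap measurableSet_Ioi
            fun r => Real.toNNReal (r ^ (n - 1)) • f (r • (θ : EuclideanSpace ℝ (Fin n))),
          setIntegral_congr_fun measurableSet_Ioi fun r hr => ?_]
        · rw [NNReal.smul_def, Real.coe_toNNReal _ (pow_nonneg (le_of_lt hr) _), smul_eq_mul]
        · exact (measurable_subtype_coe.pow_const _).real_toNNReal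

/-! ### The normalizing constant -/

/-- Positivity of the inverse also encodes convergence: a divergent integral would take the default
value `0`, with inverse `0`. -/
theorem fracConst_pos (n : ℕ) [NeZero n] {s : ℝ} (hs₀ : 0 < s) (hs₁ : s < 1) :
    0 < fracConst n s := by
  refine inv_pos.2 ?_
  have hcoord : ∀ ω : EuclideanSpace ℝ (Fin n), |ω 0| ≤ ‖ω‖ := fun ω => by
    simpa using PiLp.norm_apply_le ω 0
  have hcont : Continuous fun ω : EuclideanSpace ℝ (Fin n) => 1 - Real.cos (ω 0) := by fun_prop
  have hi := integrable_div_norm_rpow (n := n) (C := 1 / 2) (M := 2) hs₀ hs₁ one_pos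
    hcont.aestronglyMeasurable
    (fun ω _ => by
      rw [abs_of_nonneg (by linarith [Real.cos_le_one (ω 0)])]
      have h1 := Real.one_sub_sq_div_two_le_cos (x := ω 0)
      have h2 : (ω 0) ^ 2 ≤ ‖ω‖ ^ 2 := sq_le_sq' (neg_le_of_abs_le (hcoord ω)) (le_of_abs_le (hcoord ω))
      linarith)
    (fun ω => by
      rw [abs_of_nonneg (by linarith [Real.cos_le_one (ω 0)])]
      linarith [Real.neg_one_le_cos (ω 0)])
  have hnn : ∀ ω : EuclideanSpace ℝ (Fin n),
      0 ≤ (1 - Real.cos (ω 0)) / ‖ω‖ ^ ((n : ℝ) + 2 * s) := fun ω =>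
    div_nonneg (by linarith [Real.cos_le_one (ω 0)]) (Real.rpow_nonneg (norm_nonneg _) _)
  rw [integral_pos_iff_support_of_nonneg hnn hi]
  have hopen : IsOpen {ω : EuclideanSpace ℝ (Fin n) | 0 < 1 - Real.cos (ω 0)} :=
    isOpen_lt continuous_const hcont
  -- At `π` times the first basis vector, `1 - cos` equals `2`.
  have hne : {ω : EuclideanSpace ℝ (Fin n) | 0 < 1 - Real.cos (ω 0)}.Nonempty :=
    ⟨EuclideanSpace.single 0 Real.pi, by simp⟩
  refine (hopen.measure_pos volume hne).trans_le (measure_mono fun ω hω => ?_)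
  have hω' : 0 < 1 - Real.cos (ω 0) := hω
  have hω0 : 0 < ‖ω‖ := by
    rw [norm_pos_iff]
    rintro rfl
    simp at hω'
  exact (div_pos hω' (Real.rpow_pos_of_pos hω0 _)).ne'

/-! ### The second difference integral in the ball -/

theorem ballPower_eq (s : ℝ) (x : EuclideanSpace ℝ (Fin n)) (hx : ‖x‖ ≤ 1) :
    ballPower n s x = (1 - ‖x‖ ^ 2) ^ s := by
  rw [ballPower, max_eq_left]
  nlinarith [norm_nonneg x]

theorem continuous_ballPower {s : ℝ} (hs₀ : 0 ≤ s) : Continuous (ballPower n s) :=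
  Continuous.rpow_const (by fun_prop) fun _ => Or.inr hs₀

theorem ballPower_nonneg (s : ℝ) (x : EuclideanSpace ℝ (Fin n)) : 0 ≤ ballPower n s x :=
  Real.rpow_nonneg (le_max_right _ _) _

theorem ballPower_le_one {s : ℝ} (hs₀ : 0 ≤ s) (x : EuclideanSpace ℝ (Fin n)) :
    ballPower n s x ≤ 1 :=
  Real.rpow_le_one (le_max_right _ _) (max_le (by nlinarith [norm_nonneg x]) zero_le_one) hs₀

theorem second_diff_ballPower_eq {s : ℝ} {x : EuclideanSpace ℝ (Fin n)} (hx : ‖x‖ ≤ 1)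
    (y : EuclideanSpace ℝ (Fin n)) :
    2 * ballPower n s x - ballPower n s (x + y) - ballPower n s (x - y) =
      chordDiff s (1 - ‖x‖ ^ 2) (inner ℝ x y) ‖y‖ := by
  rw [ballPower_eq s x hx, ballPower, ballPower, chordDiff, norm_add_sq_real, norm_sub_sq_real]
  congr 3 <;> ring_nf

theorem abs_second_diff_ballPower_le_two {s : ℝ} (hs₀ : 0 ≤ s) (x y : EuclideanSpace ℝ (Fin n)) :
    |2 * ballPower n s x - ballPower n s (x + y) - ballPower n s (x - y)| ≤ 2 := by
  have h := fun z : EuclideanSpace ℝ (Fin n) => And.intro (ballPower_nonneg s z)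
    (ballPower_le_one hs₀ z)
  rw [abs_le]
  constructor <;> linarith [(h x).1, (h x).2, (h (x + y)).1, (h (x + y)).2, (h (x - y)).1, (h (x - y)).2]

theorem integrable_secondDiffQuot [NeZero n] {s : ℝ} (hs₀ : 0 < s) (hs₁ : s < 1)
    {x : EuclideanSpace ℝ (Fin n)} (hx : ‖x‖ < 1) :
    Integrable (secondDiffQuot s (ballPower n s) x) := by
  have hc : 0 < 1 - ‖x‖ ^ 2 := by nlinarith [norm_nonneg x]
  have hcont := continuous_ballPower (n := n) hs₀.le
  refine integrable_div_norm_rpow (M := 2) (ρ := (1 - ‖x‖ ^ 2) / 6)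
    (C := 2 * s * (1 - ‖x‖ ^ 2) ^ (s - 1) + 36 * (1 - ‖x‖ ^ 2) ^ (s - 2))
    hs₀ hs₁ (by positivity) ?_ (fun y hy => ?_) fun y => abs_second_diff_ballPower_le_two hs₀.le x y
  · exact Continuous.aestronglyMeasurable (by fun_prop)
  · rw [second_diff_ballPower_eq hx.le]
    refine chordDiff_le hs₀.le hs₁.le hc (by nlinarith [norm_nonneg x]) ?_ hy
    exact (abs_real_inner_le_norm x y).trans (mul_le_of_le_one_left (norm_nonneg _) hx.le)

/-- The condition `b² ≤ 1 - c` is Cauchy–Schwarz for `b = ⟨x, θ⟩`. It keeps both quadratics at most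
`c + b² ≤ 1`, so the integrand is dominated and the cutoff limit is the full integral. -/
theorem integral_Ioi_zero_chordDiff {s c b : ℝ} (hs₀ : 0 < s) (hs₁ : s < 1) (hc : 0 < c)
    (hb : b ^ 2 ≤ 1 - c) :
    ∫ r in Set.Ioi (0 : ℝ), chordDiff s c (b * r) r * r ^ (-1 - 2 * s) =
      ProbabilityTheory.beta s (1 - s) := by
  have hc₁ : c ≤ 1 := by nlinarith [sq_nonneg b]
  have hb₁ : |b| ≤ 1 := by rw [← sq_le_one_iff_abs_le_one]; linarith
  have hi : IntegrableOn (fun r : ℝ => chordDiff s c (b * r) r * r ^ (-1 - 2 * s)) (Set.Ioi 0) := by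
    refine (integrableOn_Ioi_truncated_sq_mul_rpow
      (2 * s * c ^ (s - 1) + 36 * c ^ (s - 2)) 2 hs₀ hs₁ (ρ := c / 6) (by positivity)).mono' ?_ ?_
    · refine AEStronglyMeasurable.mul (Continuous.aestronglyMeasurable ?_)
        (measurable_id.pow_const _).aestronglyMeasurable
      refine Continuous.sub (Continuous.sub continuous_const ?_) ?_ <;>
        exact Continuous.rpow_const (by fun_prop) fun _ => Or.inr hs₀.le
    · filter_upwards [ae_restrict_mem measurableSet_Ioi] with r hr
      have hr0 : 0 < r := hr
      have hp : 0 ≤ r ^ (-1 - 2 * s) := Real.rpow_nonneg hr0.le _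
      rw [norm_mul, Real.norm_of_nonneg hp, Real.norm_eq_abs]
      refine mul_le_mul_of_nonneg_right ?_ hp
      split_ifs with h
      · refine chordDiff_le hs₀.le hs₁.le hc hc₁ ?_ h
        rw [abs_mul, abs_of_pos hr0]
        exact mul_le_of_le_one_left hr0.le hb₁
      · exact abs_chordDiff_le_two hs₀.le hc.le hc₁ (by nlinarith [sq_nonneg (b + r)])
          (by nlinarith [sq_nonneg (b - r)])
  have hcov : AECover (volume.restrict (Set.Ioi (0 : ℝ))) (𝓝[>] 0) fun δ : ℝ => Set.Ioi δ :=
    { ae_eventually_mem := by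
        filter_upwards [ae_restrict_mem measurableSet_Ioi] with r hr
        exact mem_of_superset (Ioo_mem_nhdsGT hr) fun δ hδ => hδ.2
      measurableSet := fun _ => measurableSet_Ioi }
  refine tendsto_nhds_unique (hcov.integral_tendsto_of_countably_generated hi) ?_
  refine (tendsto_integral_Ioi_chordDiff hs₀ hs₁ hc hc₁ hb₁).congr' ?_
  filter_upwards [self_mem_nhdsWithin] with δ hδ
  rw [Measure.restrict_restrict measurableSet_Ioi,
    Set.inter_eq_left.2 (Set.Ioi_subset_Ioi (le_of_lt hδ))]

theorem integral_secondDiffQuot [NeZero n] {s : ℝ} (hs₀ : 0 < s) (hs₁ : s < 1)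
    {x : EuclideanSpace ℝ (Fin n)} (hx : ‖x‖ < 1) :
    ∫ y, secondDiffQuot s (ballPower n s) x y =
      sphereArea n * ProbabilityTheory.beta s (1 - s) := by
  rw [integral_polar (integrable_secondDiffQuot hs₀ hs₁ hx)]
  have hc : 0 < 1 - ‖x‖ ^ 2 := by nlinarith [norm_nonneg x]
  have hinner : ∀ θ : Metric.sphere (0 : EuclideanSpace ℝ (Fin n)) 1,
      ∫ r in Set.Ioi (0 : ℝ), r ^ (n - 1) *
        secondDiffQuot s (ballPower n s) x (r • (θ : EuclideanSpace ℝ (Fin n))) =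
      ProbabilityTheory.beta s (1 - s) := by
    intro θ
    have hθ : ‖(θ : EuclideanSpace ℝ (Fin n))‖ = 1 := by simp
    rw [← integral_Ioi_zero_chordDiff (b := inner ℝ x (θ : EuclideanSpace ℝ (Fin n))) hs₀ hs₁ hc]
    · refine setIntegral_congr_fun measurableSet_Ioi fun r hr => ?_
      have hr0 : 0 < r := hr
      have hnorm : ‖r • (θ : EuclideanSpace ℝ (Fin n))‖ = r := by
        rw [norm_smul, hθ, mul_one, Real.norm_of_nonneg hr0.le]
      simp only [secondDiffQuot]
      rw [second_diff_ballPower_eq hx.le, hnorm, pow_mul_div_rpow (NeZero.ne n) _ hr0,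
        real_inner_smul_right, mul_comm r]
    · have := abs_real_inner_le_norm x (θ : EuclideanSpace ℝ (Fin n))
      rw [hθ, mul_one] at this
      rw [sub_sub_cancel, ← sq_abs]
      gcongr
  simp_rw [hinner]
  rw [integral_const, smul_eq_mul, sphereArea]

/-! ### The principal value -/

theorem hasPVIntegral_ballPower [NeZero n] {s : ℝ} (hs₀ : 0 < s) (hs₁ : s < 1)
    {x : EuclideanSpace ℝ (Fin n)} (hx : ‖x‖ < 1) :
    HasPVIntegral (fun y => (ballPower n s x - ballPower n s y) / ‖x - y‖ ^ ((n : ℝ) + 2 * s)) x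
      (sphereArea n / 2 * ProbabilityTheory.beta s (1 - s)) := by
  set f := fun y => (ballPower n s x - ballPower n s y) / ‖x - y‖ ^ ((n : ℝ) + 2 * s) with hf
  have hcont := continuous_ballPower (n := n) hs₀.le
  have mp1 := measurePreserving_add_left (volume : Measure (EuclideanSpace ℝ (Fin n))) x
  have em1 := (MeasurableEquiv.addLeft x).measurableEmbedding
  have mp2 := Measure.measurePreserving_sub_left (volume : Measure (EuclideanSpace ℝ (Fin n))) x
  have em2 := (MeasurableEquiv.subLeft x).measurableEmbedding
  have pre1 : ∀ ε, (fun z => x + z) ⁻¹' (Metric.ball x ε)ᶜ = (Metric.ball 0 ε)ᶜ := fun ε => by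
    ext z; simp [dist_eq_norm]
  have pre2 : ∀ ε, (fun z => x - z) ⁻¹' (Metric.ball x ε)ᶜ = (Metric.ball 0 ε)ᶜ := fun ε => by
    ext z; simp [dist_eq_norm]
  have hint : ∀ ε : ℝ, 0 < ε → IntegrableOn f (Metric.ball x ε)ᶜ := by
    intro ε hε
    -- The indicator vanishes on `‖z‖ ≤ ε/2`, so `C = 0` serves; `M = 1` because the values of `𝒰`
    -- lie in `[0, 1]`.
    have h := integrable_div_norm_rpow (n := n) (C := 0) (M := 1) (ρ := ε / 2) hs₀ hs₁
      (by positivity) (f := (Metric.ball 0 ε)ᶜ.indicator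
        fun z => ballPower n s x - ballPower n s (x + z))
      ((Continuous.aestronglyMeasurable (by fun_prop)).indicator measurableSet_ball.compl)
      (fun z hz => by
        have : z ∈ Metric.ball (0 : EuclideanSpace ℝ (Fin n)) ε := by
          simp; linarith
        simp [this])
      (fun z => by
        by_cases hz : z ∈ (Metric.ball (0 : EuclideanSpace ℝ (Fin n)) ε)ᶜ
        · rw [Set.indicator_of_mem hz, abs_le]
          constructor <;> linarith [ballPower_nonneg s x, ballPower_le_one hs₀.le x,
            ballPower_nonneg s (x + z), ballPower_le_one hs₀.le (x + z)]
        · simp [Set.indicator_of_notMem hz])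
    rw [← mp1.integrableOn_comp_preimage em1, pre1,
      ← integrable_indicator_iff measurableSet_ball.compl]
    refine h.congr (Eventually.of_forall fun z => ?_)
    by_cases hz : z ∈ (Metric.ball (0 : EuclideanSpace ℝ (Fin n)) ε)ᶜ
    · simp only [Set.indicator_of_mem hz, hf, Function.comp]
      rw [sub_add_cancel_left, norm_neg]
    · simp only [Set.indicator_of_notMem hz, zero_div]
  refine ⟨hint, ?_⟩
  have hcov : AECover (volume : Measure (EuclideanSpace ℝ (Fin n))) (𝓝[>] 0)
      fun ε : ℝ => (Metric.ball 0 ε)ᶜ :=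
    { ae_eventually_mem := by
        filter_upwards [compl_mem_ae_iff.2 (measure_singleton 0)] with z hz
        have hz0 : 0 < ‖z‖ := norm_pos_iff.2 hz
        refine mem_of_superset (Ioo_mem_nhdsGT hz0) fun ε hε => ?_
        simpa using hε.2.le
      measurableSet := fun _ => measurableSet_ball.compl }
  have hlim := (hcov.integral_tendsto_of_countably_generated
    (integrable_secondDiffQuot hs₀ hs₁ hx)).div_const 2
  rw [integral_secondDiffQuot hs₀ hs₁ hx, mul_div_right_comm] at hlim
  refine hlim.congr' ?_
  filter_upwards [self_mem_nhdsWithin] with ε hε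
  have i1 := (mp1.integrableOn_comp_preimage em1).2 (hint ε hε)
  have i2 := (mp2.integrableOn_comp_preimage em2).2 (hint ε hε)
  have e1 := mp1.setIntegral_preimage_emb em1 f (Metric.ball x ε)ᶜ
  have e2 := mp2.setIntegral_preimage_emb em2 f (Metric.ball x ε)ᶜ
  rw [pre1] at i1 e1
  rw [pre2] at i2 e2
  simp only [Function.comp_def] at i1 i2
  -- The truncated second difference integral is twice the truncated principal value integral: `x +
  -- z` and `x - z` both carry the complement of the centered ball to that of the ball about `x`.
  have hsum : ∫ z in (Metric.ball 0 ε)ᶜ, secondDiffQuot s (ballPower n s) x z =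
      (∫ z in (Metric.ball 0 ε)ᶜ, f (x + z)) + ∫ z in (Metric.ball 0 ε)ᶜ, f (x - z) := by
    rw [← integral_add i1 i2]
    congr 1
    ext z
    simp only [secondDiffQuot, hf]
    rw [sub_add_cancel_left, norm_neg, sub_sub_cancel]
    ring
  rw [hsum, e1, e2]
  ring

end FracLap

theorem mainTheorem8 (n : ℕ) [NeZero n] (s : ℝ) (hs₀ : 0 < s) (hs₁ : s < 1) :
    0 < FracLap.fracConst n s ∧
    ∀ x ∈ Metric.ball (0 : EuclideanSpace ℝ (Fin n)) 1,
      Integrable (FracLap.secondDiffQuot s (FracLap.ballPower n s) x) ∧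
      FracLap.fracLaplacian s (FracLap.ballPower n s) x =
        FracLap.fracConst n s * (FracLap.sphereArea n / 2) * ProbabilityTheory.beta s (1 - s) ∧
      FracLap.HasPVIntegral
        (fun y => (FracLap.ballPower n s x - FracLap.ballPower n s y) /
          ‖x - y‖ ^ ((n : ℝ) + 2 * s)) x
        (FracLap.sphereArea n / 2 * ProbabilityTheory.beta s (1 - s)) := by
  refine ⟨FracLap.fracConst_pos n hs₀ hs₁, fun x hx => ?_⟩
  have hx' : ‖x‖ < 1 := by simpa using hx
  refine ⟨FracLap.integrable_secondDiffQuot hs₀ hs₁ hx', ?_,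
    FracLap.hasPVIntegral_ballPower hs₀ hs₁ hx'⟩
  rw [FracLap.fracLaplacian, FracLap.integral_secondDiffQuot hs₀ hs₁ hx']
  ring
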